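/- Let $W$ be a set of three prizes and let $\Delta=\{p\in\mathbb{R}_{\ge 0}^{W}:\sum_{w\in W}p(w)=1\}$ be the set of lotteries over $W$. A weighted utility preference is a binary relation $\succsim$ on $\Delta$ such that there are $u,g:W\to\mathbb{R}$, with $g$ everywhere positive or everywhere negative, for which $$p\succsim q\iff V(p)\ge V(q),\qquad V(p)=\frac{\sum_{w}p(w)g(w)u(w)}{\sum_{w}p(w)g(w)},$$ and which is strict in the sense that $\succsim$ is not an expected utility preference, i.e. is not represented by any function of the form $p\mapsto\sum_w p(w)v(w)$. Let $\Omega$ be the set of all such preferences. A menu is a finite subset of $\Delta$, and a binary menu is a menu with exactly two elements. For menus $D,A$ let $$N(D,A)=\{\succsim\in\Omega:\ A=\{x\in D: x\succsim y\ \text{for all } y\in D\}\},$$ and let $\mathcal{F}$ be the smallest field of subsets of $\Omega$ containing all sets $N(D,A)$. A random weighted utility is a finitely additive probability measure on $(\Omega,\mathcal{F})$. A joint choice $P$ assigns to any three binary menus $D_1,D_2,D_3$ a probability distribution $P_{D_1,D_2,D_3}$ over triples $(A_1,A_2,A_3)$ of nonempty subsets $A_i\subseteq D_i$ (the sets of chosen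 alternatives). It is rationalized by the random weighted utility $\mu$ if $$P_{D_1,D_2,D_3}(A_1,A_2,A_3)=\mu\bigl(N(D_1,A_1)\cap N(D_2,A_2)\cap N(D_3,A_3)\bigr)$$ for all binary menus $D_1,D_2,D_3$ and all menus $A_1,A_2,A_3$, where $P_{D_1,D_2,D_3}(A_1,A_2,A_3)=0$ unless $\emptyset\ne A_i\subseteq D_i$ for all $i$. Then every joint choice $P$ is rationalized by at most one random weighted utility: if $\mu$ and $\mu'$ are random weighted utilities that both rationalize $P$, then $\mu=\mu'$ on $\mathcal{F}$. -/

import Mathlib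

namespace RandomChoice

open Set MeasureTheory

/-- Lotteries over the finite set of prizes `W`: probability vectors indexed by `W`. -/
abbrev Lottery (W : Type*) [Fintype W] : Type _ := stdSimplex ℝ W

/-- A weak preference between lotteries; `R p q` reads: `p` is at least as good as `q`. -/
abbrev Preference (W : Type*) [Fintype W] : Type _ := Lottery W → Lottery W → Prop

/-- A menu is a finite set of lotteries. -/
abbrev Menu (W : Type*) [Fintype W] : Type _ := Finset (Lottery W)

/-- A binary menu is a menu with exactly two alternatives. -/
abbrev BinaryMenu (W : Type*) [Fintype W] : Type _ := {D : Menu W // D.card = 2}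

section Preferences

variable {W : Type*} [Fintype W]

/-- The weighted utility function
`V p = (∑ w, p w * g w * u w) / (∑ w, p w * g w)`. -/
noncomputable def weightedUtility (u g : W → ℝ) (p : Lottery W) : ℝ :=
  (∑ w, p.1 w * g w * u w) / (∑ w, p.1 w * g w)

/-- `R` is represented by a weighted utility function whose weights never vanish and are of one
sign (so that the denominator of `weightedUtility` is nonzero at every lottery). -/
def IsWeightedUtility (R : Preference W) : Prop :=
  ∃ u g : W → ℝ, ((∀ w, 0 < g w) ∨ (∀ w, g w < 0)) ∧
    ∀ p q : Lottery W, R p q ↔ weightedUtility u g q ≤ weightedUtility u g p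

/-- `R` is represented by an expected utility function. -/
def IsExpectedUtility (R : Preference W) : Prop :=
  ∃ u : W → ℝ, ∀ p q : Lottery W, R p q ↔ ∑ w, q.1 w * u w ≤ ∑ w, p.1 w * u w

/-- A (strict) weighted utility preference: one that is not an expected utility preference. -/
def IsStrictWeightedUtility (R : Preference W) : Prop :=
  IsWeightedUtility R ∧ ¬ IsExpectedUtility R

/-- The set of optimal alternatives of the menu `D` under the preference `R`. -/
def optimal (D : Menu W) (R : Preference W) : Set (Lottery W) :=
  {x | x ∈ D ∧ ∀ y ∈ D, R x y}

/-- The event, in the set `Ω` of preferences, that `A` is the set of all optimal alternatives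
in `D`. -/
def choiceEvent (Ω : Set (Preference W)) (D A : Menu W) : Set Ω :=
  {R | (A : Set (Lottery W)) = optimal D R.1}

/-- The smallest field of subsets of `Ω` that contains all choice events. -/
def choiceField (Ω : Set (Preference W)) : Set (Set Ω) :=
  generateSetAlgebra {E | ∃ D A : Menu W, E = choiceEvent Ω D A}

/-- A finitely additive probability measure on a family `F` of subsets of `S`, as a function on
`F` only. -/
@[ext]
structure FinAddProbability {S : Type*} (F : Set (Set S)) where
  /-- the probability of an event in `F` -/
  measure : F → ℝ
  nonneg : ∀ E, 0 ≤ measure E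
  total : ∀ E : F, (E : Set S) = univ → measure E = 1
  additive : ∀ E₁ E₂ E : F, Disjoint (E₁ : Set S) (E₂ : Set S) →
    (E : Set S) = (E₁ : Set S) ∪ (E₂ : Set S) → measure E = measure E₁ + measure E₂

/-- A random utility with values in the set `Ω` of preferences. -/
abbrev RandomUtility (Ω : Set (Preference W)) : Type _ := FinAddProbability (choiceField Ω)

/-- The event that `A i` is the set of all optimal alternatives in `D i`, for `i = 0, 1, 2`. -/
def jointChoiceEvent (Ω : Set (Preference W)) (D A : Fin 3 → Menu W) : Set Ω :=
  ⋂ i, choiceEvent Ω (D i) (A i)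

theorem jointChoiceEvent_mem (Ω : Set (Preference W)) (D A : Fin 3 → Menu W) :
    jointChoiceEvent Ω D A ∈ choiceField Ω := by
  have h := (isSetAlgebra_generateSetAlgebra
    (𝒜 := {E | ∃ D A : Menu W, E = choiceEvent Ω D A})).biInter_mem
    (s := fun i => choiceEvent Ω (D i) (A i)) Finset.univ
    (fun i _ => self_subset_generateSetAlgebra ⟨D i, A i, rfl⟩)
  simpa [jointChoiceEvent, choiceField] using h

end Preferences

/-- The observable behavior: for any three binary menus, the joint distribution of the sets of
chosen alternatives; these are nonempty subsets of the respective menus. -/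
structure JointChoice (W : Type*) [Fintype W] where
  /-- the joint distribution of choice across the menus `D 0`, `D 1`, `D 2` -/
  dist : (Fin 3 → BinaryMenu W) → PMF (Fin 3 → Menu W)
  feasible : ∀ D A, dist D A ≠ 0 → ∀ i, (A i).Nonempty ∧ A i ⊆ (D i).1

/-- Joint choice `ρ` is rationalized by the random utility `μ`: for all binary menus
`D 0`, `D 1`, `D 2` and all menus `A 0`, `A 1`, `A 2`, the probability that the `A i` are the
sets chosen from the `D i` is the probability under `μ` that each `A i` is the set of all optimal
alternatives in `D i`. -/
def JointChoice.IsRationalizedBy {W : Type*} [Fintype W] (ρ : JointChoice W)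
    {Ω : Set (Preference W)} (μ : RandomUtility Ω) : Prop :=
  ∀ (D : Fin 3 → BinaryMenu W) (A : Fin 3 → Menu W),
    (ρ.dist D A).toReal =
      μ.measure ⟨jointChoiceEvent Ω (fun i => (D i).1) A, jointChoiceEvent_mem Ω _ A⟩

/-- A random weighted utility: a random utility whose possible preferences are all the (strict)
weighted utility preferences. -/
abbrev RandomWeightedUtility (W : Type*) [Fintype W] : Type _ :=
  RandomUtility {R : Preference W | IsStrictWeightedUtility R}

end RandomChoice

/-!
A weighted utility preference `R` over three prizes is governed by a vector `z : ℝ³`, the cross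
product of the coefficient vectors of the numerator and the denominator of the utility: `p` is
strictly preferred to `q` exactly if `0 < (p × q) ⬝ z` (`IsWeightedUtility.exists_dotProduct_pos`).
The strict preference events `S i`, for `i = (p, q)`, are therefore open half-spaces in the
variable `z`, with normals in `ℝ³`.

Any four (or more) such normals are linearly dependent. Collecting the negative coefficients of a
relation in a set `N`, as in the proof of Radon's theorem, shows that no preference lies in all
`S i` with `i ∉ N` and outside all `S i` with `i ∈ N` (`exists_cell_strictEvent_eq_empty`). By
inclusion-exclusion, the measure of an intersection of more than three events `S i` is then
determined by the measures of intersections of fewer of them. Hence an additive set function that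
vanishes on intersections of at most three events `S i` vanishes on all their finite intersections
(`cell_empty_eq_zero`), on all atoms of the finite fields that they generate (`cell_eq_zero`), and
on all sets that depend on finitely many `S i` only (`eq_zero_of_isDeterminedBy`), which covers the
whole field of choice events. The difference of two random utilities that rationalize the same
joint choice is such a set function.
-/

namespace RandomChoice

open Set MeasureTheory Matrix

/-! ### Additive set functions determined by triple intersections -/

section Cells

variable {X ι : Type*} {S : ι → Set X}

/-- The points that lie in all of the sets `S i`, `i ∈ s`, and in none of the sets `S i`,
`i ∈ t`. -/
def cell (S : ι → Set X) (s t : Finset ι) : Set X :=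
  {x | (∀ i ∈ s, x ∈ S i) ∧ ∀ i ∈ t, x ∉ S i}

/-- Whether a point belongs to `E` depends only on which of the sets `S j`, `j ∈ J`, contain it. -/
def IsDeterminedBy (S : ι → Set X) (J : Finset ι) (E : Set X) : Prop :=
  ∀ x y, (∀ j ∈ J, x ∈ S j ↔ y ∈ S j) → (x ∈ E ↔ y ∈ E)

theorem IsDeterminedBy.mono {J K : Finset ι} {E : Set X} (h : IsDeterminedBy S J E)
    (hJK : J ⊆ K) : IsDeterminedBy S K E :=
  fun x y hxy => h x y fun j hj => hxy j (hJK hj)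

/-- A set in the field generated by events, each of which depends on finitely many `S i`, depends
on finitely many `S i`. -/
theorem exists_isDeterminedBy {𝒜 : Set (Set X)} (h : ∀ E ∈ 𝒜, ∃ J, IsDeterminedBy S J E)
    {E : Set X} (hE : E ∈ generateSetAlgebra 𝒜) : ∃ J, IsDeterminedBy S J E := by
  classical
  induction hE with
  | base E hE => exact h E hE
  | empty => exact ⟨∅, fun x y _ => Iff.rfl⟩
  | compl E _ ih =>
    obtain ⟨J, hJ⟩ := ih
    exact ⟨J, fun x y hxy => not_congr (hJ x y hxy)⟩
  | union E₁ E₂ _ _ ih₁ ih₂ =>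
    obtain ⟨J, hJ⟩ := ih₁
    obtain ⟨K, hK⟩ := ih₂
    exact ⟨J ∪ K, fun x y hxy => or_congr (hJ.mono Finset.subset_union_left x y hxy)
      (hK.mono Finset.subset_union_right x y hxy)⟩

variable {F : Set (Set X)}

theorem cell_mem (hF : IsSetAlgebra F) (hS : ∀ i, S i ∈ F) (s t : Finset ι) :
    cell S s t ∈ F := by
  have h : cell S s t = (⋂ i ∈ s, S i) ∩ ⋂ i ∈ t, (S i)ᶜ := by
    ext x; simp [cell]
  rw [h]
  exact hF.inter_mem (hF.biInter_mem s fun i _ => hS i)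
    (hF.biInter_mem t fun i _ => hF.compl_mem (hS i))

variable [DecidableEq ι]

theorem cell_insert_inter_union (E : Set X) (s t : Finset ι) (j : ι) :
    E ∩ cell S s t = E ∩ cell S (insert j s) t ∪ E ∩ cell S s (insert j t) := by
  ext x
  by_cases hx : x ∈ S j <;> simp [cell, hx]

theorem disjoint_cell_insert (E : Set X) (s t : Finset ι) (j : ι) :
    Disjoint (E ∩ cell S (insert j s) t) (E ∩ cell S s (insert j t)) := by
  rw [Set.disjoint_left]
  rintro x ⟨-, hx, -⟩ ⟨-, -, hx'⟩
  exact hx' j (Finset.mem_insert_self j t) (hx j (Finset.mem_insert_self j s))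

variable {ν : Set X → ℝ}

theorem inter_cell_eq_add (hF : IsSetAlgebra F) (hS : ∀ i, S i ∈ F)
    (hν : ∀ A ∈ F, ∀ B ∈ F, Disjoint A B → ν (A ∪ B) = ν A + ν B) {E : Set X} (hE : E ∈ F)
    (s t : Finset ι) (j : ι) :
    ν (E ∩ cell S s t) = ν (E ∩ cell S (insert j s) t) + ν (E ∩ cell S s (insert j t)) := by
  rw [cell_insert_inter_union E s t j]
  exact hν _ (hF.inter_mem hE (cell_mem hF hS _ _)) _ (hF.inter_mem hE (cell_mem hF hS _ _))
    (disjoint_cell_insert E s t j)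

theorem cell_eq_add (hF : IsSetAlgebra F) (hS : ∀ i, S i ∈ F)
    (hν : ∀ A ∈ F, ∀ B ∈ F, Disjoint A B → ν (A ∪ B) = ν A + ν B) (s t : Finset ι) (j : ι) :
    ν (cell S s t) = ν (cell S (insert j s) t) + ν (cell S s (insert j t)) := by
  simpa using inter_cell_eq_add hF hS hν hF.univ_mem s t j

/-- Inclusion-exclusion when all intersections of fewer than `n` of the sets `S i` are null: only
the term with the largest number of sets remains. -/
theorem cell_eq_neg_one_pow_mul (hF : IsSetAlgebra F) (hS : ∀ i, S i ∈ F)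
    (hν : ∀ A ∈ F, ∀ B ∈ F, Disjoint A B → ν (A ∪ B) = ν A + ν B) {n : ℕ}
    (hn : ∀ s : Finset ι, s.card < n → ν (cell S s ∅) = 0) (t : Finset ι) :
    ∀ s : Finset ι, Disjoint s t → s.card + t.card ≤ n →
      ν (cell S s t) = (-1) ^ t.card * ν (cell S (s ∪ t) ∅) := by
  induction t using Finset.induction_on with
  | empty => intro s _ _; simp
  | insert j t hj ih =>
    intro s hst hcard
    rw [Finset.disjoint_insert_right] at hst
    rw [Finset.card_insert_of_notMem hj] at hcard ⊢
    have hadd := cell_eq_add hF hS hν s t j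
    rw [ih s hst.2 (by omega),
      ih (insert j s) (by simp [hj, hst.2]) (by rw [Finset.card_insert_of_notMem hst.1]; omega),
      hn (s ∪ t) (by have := Finset.card_union_le s t; omega)] at hadd
    rw [Finset.union_insert, ← Finset.insert_union, pow_succ]
    linarith

theorem cell_empty_eq_zero (hF : IsSetAlgebra F) (hS : ∀ i, S i ∈ F)
    (hν : ∀ A ∈ F, ∀ B ∈ F, Disjoint A B → ν (A ∪ B) = ν A + ν B) {d : ℕ}
    (hd : ∀ s : Finset ι, s.card ≤ d → ν (cell S s ∅) = 0)
    (hcell : ∀ s : Finset ι, d < s.card → ∃ N ⊆ s, cell S (s \ N) N = ∅) (s : Finset ι) :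
    ν (cell S s ∅) = 0 := by
  induction hn : s.card using Nat.strong_induction_on generalizing s with
  | _ n ih =>
    rcases le_or_gt s.card d with hs | hs
    · exact hd s hs
    obtain ⟨N, hN, hempty⟩ := hcell s hs
    have h := cell_eq_neg_one_pow_mul hF hS hν (n := n) (fun s' hs' => ih _ hs' s' rfl) N (s \ N)
      Finset.sdiff_disjoint (by rw [Finset.card_sdiff_add_card_eq_card hN, hn])
    have hν0 : ν ∅ = 0 := by
      simpa using hν ∅ hF.empty_mem ∅ hF.empty_mem (disjoint_empty _)
    rw [hempty, hν0, Finset.sdiff_union_of_subset hN] at h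
    simpa using h.symm

theorem cell_eq_zero (hF : IsSetAlgebra F) (hS : ∀ i, S i ∈ F)
    (hν : ∀ A ∈ F, ∀ B ∈ F, Disjoint A B → ν (A ∪ B) = ν A + ν B)
    (h : ∀ s : Finset ι, ν (cell S s ∅) = 0) (t : Finset ι) :
    ∀ s : Finset ι, ν (cell S s t) = 0 := by
  induction t using Finset.induction_on with
  | empty => exact h
  | insert j t hj ih =>
    intro s
    have hadd := cell_eq_add hF hS hν s t j
    rw [ih, ih] at hadd
    linarith

/-- If all cells are null, then so is every set that depends on finitely many `S i`. The induction
on `J` needs the statement for the trace of `E` on an arbitrary cell. -/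
theorem eq_zero_of_isDeterminedBy (hF : IsSetAlgebra F) (hS : ∀ i, S i ∈ F)
    (hν : ∀ A ∈ F, ∀ B ∈ F, Disjoint A B → ν (A ∪ B) = ν A + ν B)
    (h : ∀ s t : Finset ι, ν (cell S s t) = 0) {E : Set X} (hE : E ∈ F) {J : Finset ι}
    (hJ : IsDeterminedBy S J E) : ν E = 0 := by
  have key : ∀ J s t : Finset ι,
      (∀ x ∈ cell S s t, ∀ y ∈ cell S s t, (∀ j ∈ J, x ∈ S j ↔ y ∈ S j) → (x ∈ E ↔ y ∈ E)) →
      ν (E ∩ cell S s t) = 0 := by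
    intro J
    induction J using Finset.induction_on with
    | empty =>
      intro s t hEst
      have hν0 : ν ∅ = 0 := by
        simpa using hν ∅ hF.empty_mem ∅ hF.empty_mem (disjoint_empty _)
      rcases (E ∩ cell S s t).eq_empty_or_nonempty with h0 | ⟨x, hxE, hx⟩
      · rw [h0, hν0]
      · rw [inter_eq_right.mpr fun y hy => (hEst x hx y hy (by simp)).mp hxE]
        exact h s t
    | insert j J _ ih =>
      intro s t hEst
      rw [inter_cell_eq_add hF hS hν hE s t j, ih, ih, add_zero]
      · rintro x ⟨hxs, hxt⟩ y ⟨hys, hyt⟩ hxy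
        simp only [Finset.forall_mem_insert] at hxt hyt hEst
        exact hEst x ⟨hxs, hxt.2⟩ y ⟨hys, hyt.2⟩ ⟨by simp [hxt.1, hyt.1], hxy⟩
      · rintro x ⟨hxs, hxt⟩ y ⟨hys, hyt⟩ hxy
        simp only [Finset.forall_mem_insert] at hxs hys hEst
        exact hEst x ⟨hxs.2, hxt⟩ y ⟨hys.2, hyt⟩ ⟨by simp [hxs.1, hys.1], hxy⟩
  simpa [cell] using key J ∅ ∅ fun x _ y _ hxy => hJ x y hxy

end Cells

/-! ### Strict preference events as half-spaces -/

/-- The event, in the set `Ω` of preferences, that `i.1` is strictly preferred to `i.2` in the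
sense that `i.2` is not at least as good as `i.1`. -/
def strictEvent {W : Type*} [Fintype W] (Ω : Set (Preference W)) (i : Lottery W × Lottery W) :
    Set Ω :=
  {R | ¬ R.1 i.2 i.1}

theorem IsWeightedUtility.refl {W : Type*} [Fintype W] {R : Preference W}
    (hR : IsWeightedUtility R) (p : Lottery W) : R p p := by
  obtain ⟨u, g, -, h⟩ := hR
  exact (h p p).mpr le_rfl

theorem IsWeightedUtility.total {W : Type*} [Fintype W] {R : Preference W}
    (hR : IsWeightedUtility R) (p q : Lottery W) : R p q ∨ R q p := by
  obtain ⟨u, g, -, h⟩ := hR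
  rw [h, h]
  exact le_total _ _

theorem sum_mul_pos {W : Type*} [Fintype W] {g : W → ℝ} (hg : ∀ w, 0 < g w) (p : Lottery W) :
    0 < ∑ w, p.1 w * g w := by
  have hp : 0 < ∑ w, p.1 w := by rw [p.2.2]; exact one_pos
  obtain ⟨w, hw, hpw⟩ := Finset.exists_lt_of_sum_lt (s := Finset.univ) (f := fun _ : W => (0 : ℝ))
    (g := p.1) (by simpa using hp)
  exact Finset.sum_pos' (fun w _ => mul_nonneg (p.2.1 w) (hg w).le) ⟨w, hw, mul_pos hpw (hg w)⟩

/-- The weights may be taken positive: changing the sign of all weights does not change the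
weighted utility. Clearing denominators, strict preference is the sign of an alternating bilinear
form, hence of a linear form in the cross product. -/
theorem IsWeightedUtility.exists_dotProduct_pos {R : Preference (Fin 3)}
    (hR : IsWeightedUtility R) :
    ∃ z : Fin 3 → ℝ, ∀ p q : Lottery (Fin 3), ¬ R q p ↔ 0 < (p.1 ⨯₃ q.1) ⬝ᵥ z := by
  obtain ⟨u, g, hg, h⟩ := hR
  refine ⟨(fun w => g w * u w) ⨯₃ g, fun p q => ?_⟩
  have hdot : ∀ r : Lottery (Fin 3), ∑ w, r.1 w * g w * u w = r.1 ⬝ᵥ fun w => g w * u w :=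
    fun r => by simp [dotProduct, mul_assoc]
  have hpq : 0 < (∑ w, p.1 w * g w) * ∑ w, q.1 w * g w := by
    rcases hg with hg | hg
    · exact mul_pos (sum_mul_pos hg p) (sum_mul_pos hg q)
    · have hneg : ∀ w, 0 < -g w := fun w => neg_pos.mpr (hg w)
      have hp := sum_mul_pos hneg p
      have hq := sum_mul_pos hneg q
      simp only [mul_neg, Finset.sum_neg_distrib] at hp hq
      nlinarith
  have hp0 := left_ne_zero_of_mul hpq.ne'
  have hq0 := right_ne_zero_of_mul hpq.ne'
  rw [h, not_le, cross_dot_cross, ← hdot, ← hdot, ← sub_pos (b := weightedUtility u g q)]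
  change _ ↔ 0 < _ * (∑ w, q.1 w * g w) - (∑ w, p.1 w * g w) * _
  rw [weightedUtility, weightedUtility, div_sub_div _ _ hp0 hq0, div_pos_iff_of_pos_right hpq]

/-- More than three normals in `ℝ³` are linearly dependent. In a relation with a positive
coefficient, `N` is the set of indices with a negative coefficient: on the cell, every term of the
relation is nonnegative and one is positive. -/
theorem exists_cell_strictEvent_eq_empty {Ω : Set (Preference (Fin 3))}
    (hΩ : ∀ R ∈ Ω, IsWeightedUtility R) [DecidableEq (Lottery (Fin 3) × Lottery (Fin 3))]
    (s : Finset (Lottery (Fin 3) × Lottery (Fin 3))) (hs : 3 < s.card) :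
    ∃ N ⊆ s, cell (strictEvent Ω) (s \ N) N = ∅ := by
  let n : Lottery (Fin 3) × Lottery (Fin 3) → Fin 3 → ℝ := fun i => i.1.1 ⨯₃ i.2.1
  have hdep : ¬ LinearIndepOn ℝ n (s : Set (Lottery (Fin 3) × Lottery (Fin 3))) := by
    intro hli
    have := LinearIndependent.fintype_card_le_finrank hli
    simp at this
    omega
  rw [linearIndepOn_finset_iff] at hdep
  push Not at hdep
  obtain ⟨f, hf, i, hi, hfi⟩ := hdep
  obtain ⟨f, hf, i, hi, hfi⟩ : ∃ f : Lottery (Fin 3) × Lottery (Fin 3) → ℝ,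
      ∑ j ∈ s, f j • n j = 0 ∧ ∃ i ∈ s, 0 < f i := by
    rcases hfi.lt_or_gt with hlt | hlt
    · exact ⟨-f, by simp [hf], i, hi, by simpa using hlt⟩
    · exact ⟨f, hf, i, hi, hlt⟩
  refine ⟨s.filter fun j => f j < 0, Finset.filter_subset _ _, ?_⟩
  rw [Set.eq_empty_iff_forall_notMem]
  rintro R ⟨hpos, hneg⟩
  obtain ⟨z, hz⟩ := (hΩ R.1 R.2).exists_dotProduct_pos
  have hmem : ∀ j, R ∈ strictEvent Ω j ↔ 0 < n j ⬝ᵥ z := fun j => hz j.1 j.2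
  have hterm : ∀ j ∈ s, 0 ≤ f j * (n j ⬝ᵥ z) := by
    intro j hj
    by_cases hfj : f j < 0
    · have := hneg j (Finset.mem_filter.mpr ⟨hj, hfj⟩)
      rw [hmem, not_lt] at this
      exact mul_nonneg_of_nonpos_of_nonpos hfj.le this
    · have := hpos j (by simp [hj, hfj])
      rw [hmem] at this
      exact mul_nonneg (not_lt.mp hfj) this.le
  have hi_pos : 0 < f i * (n i ⬝ᵥ z) :=
    mul_pos hfi ((hmem i).mp (hpos i (by simp [hi, hfi.le])))
  have hsum : ∑ j ∈ s, f j * (n j ⬝ᵥ z) = 0 := by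
    have := congrArg (· ⬝ᵥ z) hf
    simpa [sum_dotProduct, smul_dotProduct] using this
  exact (Finset.sum_pos' hterm ⟨i, hi, hi_pos⟩).ne' hsum

/-! ### Choice events and strict preference events -/

section Choice

variable {W : Type*} [Fintype W] {Ω : Set (Preference W)}

theorem choiceEvent_isDeterminedBy (D A : Menu W) :
    IsDeterminedBy (strictEvent Ω) (D ×ˢ D) (choiceEvent Ω D A) := by
  intro R R' hRR'
  have h : optimal D R.1 = optimal D R'.1 := by
    ext x
    refine and_congr_right fun hx => forall₂_congr fun y hy => ?_
    exact not_iff_not.mp (hRR' (y, x) (Finset.mk_mem_product hy hx))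
  simp only [choiceEvent, mem_ofPred_eq, h]

theorem strictEvent_self_eq_empty (hΩ : ∀ R ∈ Ω, IsWeightedUtility R) (p : Lottery W) :
    strictEvent Ω (p, p) = ∅ :=
  eq_empty_of_forall_notMem fun R hR => hR ((hΩ R.1 R.2).refl p)

theorem strictEvent_eq_choiceEvent [DecidableEq (Lottery W)] (hΩ : ∀ R ∈ Ω, IsWeightedUtility R)
    {p q : Lottery W} (hpq : p ≠ q) : strictEvent Ω (p, q) = choiceEvent Ω {p, q} {p} := by
  ext R
  have hrefl := (hΩ R.1 R.2).refl
  constructor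
  · intro hR
    have hRpq : R.1 p q := ((hΩ R.1 R.2).total p q).resolve_right hR
    have hR' : ¬ R.1 q p := hR
    ext x
    simp only [optimal, Finset.coe_singleton, mem_singleton_iff, Finset.mem_insert,
      Finset.mem_singleton, mem_ofPred_eq, forall_eq_or_imp, forall_eq]
    constructor
    · rintro rfl
      exact ⟨Or.inl rfl, hrefl x, hRpq⟩
    · rintro ⟨rfl | rfl, h, -⟩
      · rfl
      · exact absurd h hR'
  · intro hR hqp
    have hq : q ∈ (({p} : Menu W) : Set (Lottery W)) := by
      rw [show (({p} : Menu W) : Set (Lottery W)) = _ from hR]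
      exact ⟨by simp, by simpa using ⟨hqp, hrefl q⟩⟩
    exact hpq (by simpa using hq : q = p).symm

theorem strictEvent_mem (hΩ : ∀ R ∈ Ω, IsWeightedUtility R) (i : Lottery W × Lottery W) :
    strictEvent Ω i ∈ choiceField Ω := by
  classical
  obtain ⟨p, q⟩ := i
  rcases eq_or_ne p q with rfl | hpq
  · rw [strictEvent_self_eq_empty hΩ]
    exact isSetAlgebra_generateSetAlgebra.empty_mem
  · exact self_subset_generateSetAlgebra ⟨_, _, strictEvent_eq_choiceEvent hΩ hpq⟩

open Classical in
/-- The difference of two finitely additive probability measures on `F`, with value `0` at sets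
outside `F`. -/
noncomputable def FinAddProbability.difference {S : Type*} {F : Set (Set S)}
    (μ μ' : FinAddProbability F) (E : Set S) : ℝ :=
  if hE : E ∈ F then μ.measure ⟨E, hE⟩ - μ'.measure ⟨E, hE⟩ else 0

theorem FinAddProbability.difference_union {S : Type*} {F : Set (Set S)} (hF : IsSetAlgebra F)
    (μ μ' : FinAddProbability F) (A : Set S) (hA : A ∈ F) (B : Set S) (hB : B ∈ F)
    (hAB : Disjoint A B) :
    μ.difference μ' (A ∪ B) = μ.difference μ' A + μ.difference μ' B := by
  simp only [difference, hA, hB, hF.union_mem hA hB, dite_true]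
  rw [μ.additive ⟨A, hA⟩ ⟨B, hB⟩ ⟨A ∪ B, hF.union_mem hA hB⟩ hAB rfl,
    μ'.additive ⟨A, hA⟩ ⟨B, hB⟩ ⟨A ∪ B, hF.union_mem hA hB⟩ hAB rfl]
  ring

theorem FinAddProbability.difference_empty {S : Type*} {F : Set (Set S)} (hF : IsSetAlgebra F)
    (μ μ' : FinAddProbability F) : μ.difference μ' ∅ = 0 := by
  simpa using difference_union hF μ μ' ∅ hF.empty_mem ∅ hF.empty_mem (disjoint_empty _)

theorem JointChoice.IsRationalizedBy.difference_iInter_strictEvent {ρ : JointChoice W}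
    (hΩ : ∀ R ∈ Ω, IsWeightedUtility R) {μ μ' : RandomUtility Ω}
    (hμ : ρ.IsRationalizedBy μ) (hμ' : ρ.IsRationalizedBy μ') (i : Fin 3 → Lottery W × Lottery W) :
    μ.difference μ' (⋂ k, strictEvent Ω (i k)) = 0 := by
  classical
  by_cases hi : ∀ k, (i k).1 ≠ (i k).2
  · let D : Fin 3 → BinaryMenu W := fun k => ⟨{(i k).1, (i k).2}, Finset.card_pair (hi k)⟩
    have h : ⋂ k, strictEvent Ω (i k) = jointChoiceEvent Ω (fun k => (D k).1) fun k => {(i k).1} :=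
      iInter_congr fun k => strictEvent_eq_choiceEvent hΩ (hi k)
    rw [h, FinAddProbability.difference, dif_pos (jointChoiceEvent_mem Ω _ _), ← hμ D, ← hμ' D,
      sub_self]
  · push Not at hi
    obtain ⟨k, hk⟩ := hi
    have h : ⋂ k, strictEvent Ω (i k) = ∅ := by
      refine subset_empty_iff.mp ((iInter_subset _ k).trans ?_)
      rw [show i k = ((i k).1, (i k).1) from Prod.ext rfl hk.symm, strictEvent_self_eq_empty hΩ]
    rw [h]
    exact FinAddProbability.difference_empty isSetAlgebra_generateSetAlgebra μ μ'

/-- A nonempty set of at most three pairs is listed, with repetitions, by a function on `Fin 3`;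
the empty set of pairs corresponds to the sure event. -/
theorem JointChoice.IsRationalizedBy.difference_cell_strictEvent {ρ : JointChoice W}
    (hΩ : ∀ R ∈ Ω, IsWeightedUtility R) {μ μ' : RandomUtility Ω}
    (hμ : ρ.IsRationalizedBy μ) (hμ' : ρ.IsRationalizedBy μ')
    (s : Finset (Lottery W × Lottery W)) (hs : s.card ≤ 3) :
    μ.difference μ' (cell (strictEvent Ω) s ∅) = 0 := by
  rcases s.eq_empty_or_nonempty with rfl | hne
  · have h : cell (strictEvent Ω) ∅ ∅ = univ := by simp [cell]
    have huniv : univ ∈ choiceField Ω := isSetAlgebra_generateSetAlgebra.univ_mem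
    rw [h, FinAddProbability.difference, dif_pos huniv, μ.total _ rfl, μ'.total _ rfl, sub_self]
  · have : Nonempty s := hne.to_subtype
    obtain ⟨e⟩ : Nonempty (s ↪ Fin 3) :=
      Function.Embedding.nonempty_of_card_le (by simpa using hs)
    have hsurj := Function.invFun_surjective e.injective
    have h : cell (strictEvent Ω) s ∅ =
        ⋂ k, strictEvent Ω ((Function.invFun e k : s) : Lottery W × Lottery W) := by
      ext R
      simp only [cell, mem_iInter, mem_ofPred_eq, Finset.notMem_empty, false_implies, implies_true,
        and_true]
      rw [← hsurj.forall (p := fun j : s => R ∈ strictEvent Ω j)]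
      simp
    rw [h]
    exact hμ.difference_iInter_strictEvent hΩ hμ' _

end Choice

end RandomChoice

open RandomChoice MeasureTheory in
theorem proposition4 (ρ : RandomChoice.JointChoice (Fin 3))
    (μ μ' : RandomChoice.RandomWeightedUtility (Fin 3))
    (hμ : ρ.IsRationalizedBy μ) (hμ' : ρ.IsRationalizedBy μ') :
    μ = μ' := by
  classical
  have hΩ : ∀ R ∈ {R : RandomChoice.Preference (Fin 3) | RandomChoice.IsStrictWeightedUtility R},
      RandomChoice.IsWeightedUtility R := fun R hR => hR.1
  have hF : IsSetAlgebra (choiceField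
      {R : RandomChoice.Preference (Fin 3) | RandomChoice.IsStrictWeightedUtility R}) :=
    isSetAlgebra_generateSetAlgebra
  have hν := FinAddProbability.difference_union hF μ μ'
  have hS := strictEvent_mem hΩ
  have hcell := cell_eq_zero hF hS hν (cell_empty_eq_zero hF hS hν
    (hμ.difference_cell_strictEvent hΩ hμ') (exists_cell_strictEvent_eq_empty hΩ))
  ext E
  obtain ⟨E, hE⟩ := E
  obtain ⟨J, hJ⟩ := exists_isDeterminedBy (S := strictEvent
    {R : RandomChoice.Preference (Fin 3) | RandomChoice.IsStrictWeightedUtility R})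
    (by rintro _ ⟨D, A, rfl⟩; exact ⟨D ×ˢ D, choiceEvent_isDeterminedBy D A⟩) hE
  have h := eq_zero_of_isDeterminedBy hF hS hν (fun s t => hcell t s) hE hJ
  rw [FinAddProbability.difference, dif_pos hE] at h
  exact sub_eq_zero.mp h
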